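/- Let $G$ be a locally compact, $\sigma$-compact abelian topological group acting continuously and minimally (every orbit $Gx$ is dense) on a non-empty compact metric space $(X,d)$, and let $m\ge 2$ be an integer. A pair $(x,y)\in X^2$ is \emph{proximal} if for every $\varepsilon>0$ there is $g\in G$ with $d(gx,gy)<\varepsilon$. It is \emph{regionally proximal}, written $(x,y)\in Q_2(X,G)$, if for every $\varepsilon>0$ there are $x',y'\in X$ and $g\in G$ with $d(x,x')<\varepsilon$, $d(y,y')<\varepsilon$ and $d(gx',gy')<\varepsilon$. A continuous action of $G$ on a compact metric space $(Y,\rho)$ is \emph{equicontinuous} if for every $\varepsilon>0$ there is $\delta>0$ such that $\rho(y,y')<\delta$ implies $\rho(gy,gy')<\varepsilon$ for all $g\in G$. Let $\pi_{eq}\colon X\to X_{eq}$ be the maximal equicontinuous factor of $(X,G)$, that is, the equicontinuous factor through which every equicontinuous factor of $(X,G)$ factors. For $y\in X_{eq}$ the \emph{coincidence rank} is $$r_c(X,G)=\sup\{n\ge 1:\ \exists\, x_1,\dots,x_n\in\pi_{eq}^{-1}(y)\ \text{such that } (x_i,x_j) \text{ is not proximal for all } i\ne j\}\in\mathbb N\cup\{\infty\}.$$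 Then, for every choice of $y\in X_{eq}$ in the definition of $r_c(X,G)$, the following conditions are equivalent. 1. $(X,G)$ is compactly $m$-sensitive: there exists $\varepsilon>0$ such that for every non-empty open set $U\subset X$ and every compact set $K\subset G$ there exist $x_1,\dots,x_m\in U$ and $h\in G$ with $$Kh\subset\{g\in G: d(gx_i,gx_j)>\varepsilon \text{ for all } i\ne j\}.$$ 2. There exists $\delta>0$ such that for every non-empty open set $U\subset X$ there exist $x_1,\dots,x_m\in X$ with $x_1\in U$, $(x_i,x_j)\in Q_2(X,G)$ for all $i,j$, and $$\inf_{g\in G}d(gx_i,gx_j)>\delta\quad\text{for all } i\neq j.$$ 3. $r_c(X,G)\ge m$. -/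

import Mathlib

open Set Topology
open scoped Pointwise

universe u v

namespace TopDyn

/-- The pair `(x, y)` is proximal. -/
def IsProximalPair (G : Type u) {X : Type v} [Group G] [MetricSpace X] [MulAction G X]
    (x y : X) : Prop :=
  ∀ ε : ℝ, 0 < ε → ∃ g : G, dist (g • x) (g • y) < ε

/-- The tuple `x` belongs to `Q_m(X, G)`, i.e. it is `m`-regionally proximal. -/
def IsRegionallyProximal (G : Type u) {X : Type v} [Group G] [MetricSpace X] [MulAction G X]
    {m : ℕ} (x : Fin m → X) : Prop :=
  ∀ ε : ℝ, 0 < ε → ∃ x' : Fin m → X, (∀ i, dist (x i) (x' i) < ε) ∧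
    ∃ g : G, ∀ i j, dist (g • x' i) (g • x' j) < ε

/-- Compact `m`-sensitivity of the action of `G` on `X`. -/
def CompactlySensitive (G : Type u) (X : Type v) [Group G] [TopologicalSpace G] [MetricSpace X]
    [MulAction G X] (m : ℕ) : Prop :=
  ∃ ε : ℝ, 0 < ε ∧ ∀ U : Set X, IsOpen U → U.Nonempty → ∀ K : Set G, IsCompact K →
    ∃ x : Fin m → X, (∀ i, x i ∈ U) ∧ ∃ h : G,
      K * {h} ⊆ {g : G | ∀ i j, i ≠ j → ε < dist (g • x i) (g • x j)}

/-- The action of `G` on the metric space `Y` is equicontinuous. -/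
def EquicontinuousAction (G : Type u) (Y : Type v) [Group G] [MetricSpace Y]
    [MulAction G Y] : Prop :=
  ∀ ε : ℝ, 0 < ε → ∃ δ : ℝ, 0 < δ ∧ ∀ x y : Y, dist x y < δ → ∀ g : G, dist (g • x) (g • y) < ε

/-- `φ` is a factor map: a surjective continuous equivariant map. -/
structure IsFactorMap (G : Type u) {X Y : Type*} [Group G] [TopologicalSpace X]
    [TopologicalSpace Y] [MulAction G X] [MulAction G Y] (φ : X → Y) : Prop where
  surjective : Function.Surjective φ
  continuous : Continuous φ
  map_smul : ∀ (g : G) (x : X), φ (g • x) = g • φ x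

section MaximalEquicontinuousFactor

variable (G : Type u) (X : Type v) [Group G] [TopologicalSpace G] [MetricSpace X] [MulAction G X]

/-- The equicontinuous structure relation: two points are related when every equicontinuous
factor of `(X, G)` (a continuous action on a compact metric space) identifies them. -/
def EqRel (x y : X) : Prop :=
  ∀ (Y : Type v) [MetricSpace Y] [CompactSpace Y] [MulAction G Y] [ContinuousSMul G Y],
    EquicontinuousAction G Y → ∀ φ : X → Y, IsFactorMap G φ → φ x = φ y

/-- The equicontinuous structure relation as an equivalence relation. -/
def eqSetoid : Setoid X where
  r := EqRel G X
  iseqv :=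
    { refl := fun _ _ _ _ _ _ _ _ _ => rfl
      symm := fun h Y _ _ _ _ hY φ hφ => (h Y hY φ hφ).symm
      trans := fun h k Y _ _ _ _ hY φ hφ => (h Y hY φ hφ).trans (k Y hY φ hφ) }

/-- The maximal equicontinuous factor `X_eq`, with the quotient topology. The theorems below show
that it is a continuous action on a compact metrizable space, that it is equicontinuous, and that
every equicontinuous factor of `(X, G)` is a factor of it. -/
def MaxEqFactor : Type v := Quotient (eqSetoid G X)

/-- The maximal equicontinuous factor map `π_eq`. -/
def piEq (x : X) : MaxEqFactor G X := Quotient.mk (eqSetoid G X) x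

instance instTopologicalSpaceMaxEqFactor : TopologicalSpace (MaxEqFactor G X) :=
  inferInstanceAs (TopologicalSpace (Quotient (eqSetoid G X)))

instance : MulAction G (MaxEqFactor G X) where
  smul g := Quotient.map (fun x => g • x) (fun x y (h : EqRel G X x y) Y _ _ _ _ hY φ hφ => by
    rw [hφ.map_smul, hφ.map_smul, h Y hY φ hφ])
  one_smul y := by
    induction y using Quotient.inductionOn with
    | h x => exact congrArg (piEq G X) (one_smul G x)
  mul_smul g h y := by
    induction y using Quotient.inductionOn with
    | h x => exact congrArg (piEq G X) (mul_smul g h x)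

theorem isFactorMap_piEq : IsFactorMap G (piEq G X) where
  surjective := Quotient.mk_surjective
  continuous := continuous_quotient_mk'
  map_smul _ _ := rfl

/-- Every equicontinuous factor of `(X, G)` is a factor of `X_eq`, through a unique map
compatible with `π_eq`. -/
theorem piEq_universal (Y : Type v) [MetricSpace Y] [CompactSpace Y] [MulAction G Y]
    [ContinuousSMul G Y] (hY : EquicontinuousAction G Y) (φ : X → Y) (hφ : IsFactorMap G φ) :
    ∃! ψ : MaxEqFactor G X → Y, IsFactorMap G ψ ∧ ψ ∘ piEq G X = φ := by
  refine ⟨fun z => Quotient.lift φ (fun x y (h : EqRel G X x y) => h Y hY φ hφ) z, ⟨⟨?_, ?_, ?_⟩, rfl⟩, ?_⟩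
  · intro y
    obtain ⟨x, rfl⟩ := hφ.surjective y
    exact ⟨piEq G X x, rfl⟩
  · exact hφ.continuous.quotient_lift _
  · intro g z
    obtain ⟨x, rfl⟩ := (isFactorMap_piEq G X).surjective z
    exact hφ.map_smul g x
  · rintro ψ ⟨-, hψ⟩
    funext z
    obtain ⟨x, rfl⟩ := (isFactorMap_piEq G X).surjective z
    exact congrFun hψ x

instance [CompactSpace X] : CompactSpace (MaxEqFactor G X) :=
  inferInstanceAs (CompactSpace (Quotient (eqSetoid G X)))

theorem exists_factor_separating {a b : MaxEqFactor G X} (hab : a ≠ b) :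
    ∃ (Y : Type v) (_ : MetricSpace Y) (_ : CompactSpace Y) (_ : MulAction G Y)
      (_ : ContinuousSMul G Y) (ψ : MaxEqFactor G X → Y),
      EquicontinuousAction G Y ∧ IsFactorMap G ψ ∧ ψ a ≠ ψ b := by
  obtain ⟨x, rfl⟩ := (isFactorMap_piEq G X).surjective a
  obtain ⟨y, rfl⟩ := (isFactorMap_piEq G X).surjective b
  have h : ¬ EqRel G X x y := fun h => hab (Quotient.sound h)
  simp only [EqRel, not_forall] at h
  obtain ⟨Y, i1, i2, i3, i4, hY, φ, hφ, hne⟩ := h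
  obtain ⟨ψ, ⟨hψ, hc⟩, -⟩ := piEq_universal G X Y hY φ hφ
  refine ⟨Y, i1, i2, i3, i4, ψ, hY, hψ, ?_⟩
  have h1 := congrFun hc x
  have h2 := congrFun hc y
  simp only [Function.comp_apply] at h1 h2
  rwa [h1, h2]

instance : T2Space (MaxEqFactor G X) := by
  refine ⟨fun a b hab => ?_⟩
  obtain ⟨Y, _, _, _, _, ψ, -, hψ, hne⟩ := exists_factor_separating G X hab
  exact separated_by_continuous hψ.continuous hne

variable [CompactSpace X]

theorem isClosedMap_piEq : IsClosedMap (piEq G X) :=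
  (isFactorMap_piEq G X).continuous.isClosedMap

instance : SecondCountableTopology (MaxEqFactor G X) := by
  obtain ⟨B, hBc, -, hB⟩ := TopologicalSpace.exists_countable_basis X
  have hcl := isClosedMap_piEq G X
  have hπ := isFactorMap_piEq G X
  let W : Set (Set X) → Set (MaxEqFactor G X) := fun F => (piEq G X '' (⋃₀ F)ᶜ)ᶜ
  have hW : ∀ F : Set (Set X), F ⊆ B → IsOpen (W F) := fun F hF =>
    (hcl _ (isOpen_sUnion fun s hs => hB.isOpen (hF hs)).isClosed_compl).isOpen_compl
  have hbasis : TopologicalSpace.IsTopologicalBasis (W '' {F | F.Finite ∧ F ⊆ B}) := by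
    refine TopologicalSpace.isTopologicalBasis_of_isOpen_of_nhds ?_ ?_
    · rintro _ ⟨F, ⟨-, hF⟩, rfl⟩
      exact hW F hF
    · intro y V hy hV
      have hk : IsCompact (piEq G X ⁻¹' {y}) :=
        (isClosed_singleton.preimage hπ.continuous).isCompact
      obtain ⟨F, hF, hFfin, hcov⟩ := hk.elim_finite_subcover_image
        (b := {s | s ∈ B ∧ s ⊆ piEq G X ⁻¹' V}) (c := id) (fun s hs => hB.isOpen hs.1) (by
          intro x hx
          have hxV : x ∈ piEq G X ⁻¹' V := by
            have : piEq G X x = y := hx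
            simpa [this] using hy
          obtain ⟨s, hs, hxs, hsV⟩ := hB.exists_subset_of_mem_open hxV (hV.preimage hπ.continuous)
          exact mem_biUnion (show s ∈ {s | s ∈ B ∧ s ⊆ piEq G X ⁻¹' V} from ⟨hs, hsV⟩) hxs)
      refine ⟨W F, ⟨F, ⟨hFfin, fun s hs => (hF hs).1⟩, rfl⟩, ?_, ?_⟩
      · rintro ⟨x, hx, hxy⟩
        apply hx
        have := hcov hxy
        simpa [mem_sUnion] using this
      · intro z hz
        obtain ⟨x, rfl⟩ := hπ.surjective z
        by_contra hzV
        refine hz ⟨x, ?_, rfl⟩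
        rintro ⟨s, hs, hxs⟩
        exact hzV ((hF hs).2 hxs)
  exact hbasis.secondCountableTopology
    ((countable_ofPred_finite_subset hBc).image W)

instance : TopologicalSpace.MetrizableSpace (MaxEqFactor G X) :=
  TopologicalSpace.metrizableSpace_of_t3_secondCountable _

instance [ContinuousSMul G X] : ContinuousSMul G (MaxEqFactor G X) := by
  have hπ := isFactorMap_piEq G X
  have hp : IsProperMap (piEq G X) := hπ.continuous.isProperMap
  have hq : IsQuotientMap (Prod.map (id : G → G) (piEq G X)) :=
    ((isProperMap_id (X := G)).prodMap hp).isClosedMap.isQuotientMap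
      (continuous_id.prodMap hπ.continuous) (Function.surjective_id.prodMap hπ.surjective)
  refine ⟨hq.continuous_iff.2 ?_⟩
  exact hπ.continuous.comp (continuous_smul (M := G) (X := X))

/-- `X_eq` is equicontinuous for every compatible metric. -/
theorem equicontinuousAction_maxEqFactor (d : MetricSpace (MaxEqFactor G X))
    (hd : d.toUniformSpace.toTopologicalSpace = instTopologicalSpaceMaxEqFactor G X) :
    EquicontinuousAction G (MaxEqFactor G X) := by
  let τ := instTopologicalSpaceMaxEqFactor G X
  let F : G → MaxEqFactor G X → MaxEqFactor G X := fun g z => g • z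
  let S : Type v := {w : UniformSpace (MaxEqFactor G X) //
    τ ≤ w.toTopologicalSpace ∧ UniformEquicontinuous (uα := w) (uβ := w) F}
  let w₀ : UniformSpace (MaxEqFactor G X) := ⨅ w : S, w.1
  have hle : τ ≤ w₀.toTopologicalSpace := by
    rw [UniformSpace.toTopologicalSpace_iInf]
    exact le_iInf fun w => w.2.1
  have hequi : UniformEquicontinuous (uα := w₀) (uβ := w₀) F :=
    uniformEquicontinuous_iInf_rng.2 fun w => by
      let _ : UniformSpace (MaxEqFactor G X) := w.1
      exact uniformEquicontinuous_iInf_dom (u := fun w : S => w.1) (k := w) w.2.2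
  have hT2 : @T2Space _ w₀.toTopologicalSpace := by
    refine @T2Space.mk _ w₀.toTopologicalSpace fun a b hab => ?_
    obtain ⟨Y, _, _, _, _, ψ, hY, hψ, hx⟩ := exists_factor_separating G X hab
    let wY : UniformSpace (MaxEqFactor G X) := UniformSpace.comap ψ inferInstance
    have hwY : τ ≤ wY.toTopologicalSpace := continuous_iff_le_induced.1 hψ.continuous
    have hYu : UniformEquicontinuous (fun (g : G) (z : Y) => g • z) :=
      Metric.uniformEquicontinuous_iff.2 hY
    have hwY' : UniformEquicontinuous (uα := wY) (uβ := wY) F := by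
      intro V hV
      obtain ⟨V', hV', hVV⟩ := Filter.mem_comap.1 hV
      have h1 := Filter.preimage_mem_comap (m := Prod.map ψ ψ) (hYu V' hV')
      refine Filter.mem_of_superset h1 ?_
      rintro ⟨p, q⟩ hpq g
      refine hVV ?_
      have := hpq g
      simpa [F, hψ.map_smul] using this
    have hcont : @Continuous _ _ w₀.toTopologicalSpace _ ψ := by
      rw [continuous_iff_le_induced, UniformSpace.toTopologicalSpace_iInf]
      exact iInf_le (fun w : S => w.1.toTopologicalSpace) ⟨wY, hwY, hwY'⟩
    obtain ⟨A, B, hA, hB, hxA, hyB, hAB⟩ := t2_separation hx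
    exact ⟨ψ ⁻¹' A, ψ ⁻¹' B,
      @IsOpen.preimage _ _ w₀.toTopologicalSpace _ _ hcont _ hA,
      @IsOpen.preimage _ _ w₀.toTopologicalSpace _ _ hcont _ hB, hxA, hyB, hAB.preimage ψ⟩
  have heq : w₀.toTopologicalSpace = τ := by
    refine le_antisymm ?_ hle
    have hid : @Continuous _ _ τ w₀.toTopologicalSpace id := continuous_id_iff_le.2 hle
    have hcl := @Continuous.isClosedMap _ _ τ w₀.toTopologicalSpace _ hT2 _ hid
    intro U hU
    have h1 : @IsClosed _ w₀.toTopologicalSpace (id '' Uᶜ) :=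
      hcl _ ((@isClosed_compl_iff _ τ U).2 hU)
    rw [image_id] at h1
    exact (@isClosed_compl_iff _ w₀.toTopologicalSpace U).1 h1
  have hu : d.toUniformSpace = w₀ := unique_uniformity_of_compact hd heq
  have hd' : UniformEquicontinuous (uα := d.toUniformSpace) (uβ := d.toUniformSpace) F := by
    rw [hu]
    exact hequi
  exact Metric.uniformEquicontinuous_iff.1 hd'

end MaximalEquicontinuousFactor

/-- The coincidence rank `r_c(X, G)` computed in the fibre of `π_eq` over `y`: the supremum, in
`ℕ∞`, of the numbers of pairwise non-proximal points in that fibre. -/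
noncomputable def coincidenceRank {G : Type u} {X : Type v} [Group G] [TopologicalSpace G]
    [MetricSpace X] [MulAction G X] (y : MaxEqFactor G X) : ℕ∞ :=
  sSup {k : ℕ∞ | ∃ n : ℕ, 1 ≤ n ∧ k = n ∧ ∃ x : Fin n → X, (∀ i, piEq G X (x i) = y) ∧
    ∀ i j, i ≠ j → ¬ IsProximalPair G (x i) (x j)}

end TopDyn

/-! The hard implication is 3 → 1. Separated tuples in one fibre of `π_eq` must be perturbed
slightly and then moved by one group element into an arbitrarily small open set. For this, the
closed invariant set N generated by a box around the tuple has to meet the diagonal.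

The tool is an invariant probability measure μ, which exists because G is abelian and has full
support by minimality. For a closed invariant N ⊆ X × Y, the sections N_x all have the same measure
and depend upper semicontinuously on x. Hence D(a, b) = μ(N_a ∆ N_b) is a continuous invariant
pseudometric on X, and such a pseudometric vanishes on the fibres of `π_eq`. An open set inside N_a
therefore lies in N_b whenever a and b share a fibre (`EqRel.subset_section`). Applied one
coordinate at a time, this enlarges the sides of a box inside N to the interiors of their
saturations (`pi_saturationInterior_subset`). By Baire category some fibre lies inside all the
enlarged sides (`exists_fibre_subset_saturationInterior`), so over that fibre N contains diagonal
points.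

For 1 → 2, exhaust G by compact sets and take a limit of the sensitive tuples. For 2 → 3, only the
easy inclusion of Q_2 in the equicontinuous structure relation is needed. In 2 → 3 and 3 → 1,
minimality carries separated tuples from one fibre to any other, so the choice of y is immaterial.
-/

namespace TopDyn

/-! ### Invariant measures for abelian group actions (Markov–Kakutani). -/

section InvariantMeasure

open MeasureTheory
open scoped ENNReal NNReal

/-- A commuting family of continuous self-maps of a non-empty compact Hausdorff space has a point
common to all the ranges. -/
theorem exists_forall_mem_range_of_commute {P ι : Type*} [TopologicalSpace P] [CompactSpace P]
    [T2Space P] [Nonempty P] (T : ι → P → P) (hT : ∀ i, Continuous (T i))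
    (hc : ∀ i j, Function.Commute (T i) (T j)) : ∃ p, ∀ i, p ∈ range (T i) := by
  classical
  -- S is the composite of the maps indexed by s. Since they commute, any of them can be written
  -- last, so each range contains that of S. This gives the finite intersection property.
  have hfin : ∀ s : Finset ι, ∃ S : P → P, (∀ i ∈ s, range S ⊆ range (T i)) ∧
      ∀ j, Function.Commute S (T j) := by
    intro s
    induction s using Finset.induction_on with
    | empty => exact ⟨id, by simp, fun j => Function.Semiconj.id_left⟩
    | insert i s _ ih =>
      obtain ⟨S, hS, hSc⟩ := ih
      refine ⟨T i ∘ S, ?_, fun j => (hc i j).comp_left (hSc j)⟩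
      intro k hk
      rcases Finset.mem_insert.1 hk with rfl | hk
      · exact range_comp_subset_range _ _
      · rw [← (hSc i).comp_eq]
        exact (range_comp_subset_range _ _).trans (hS k hk)
  have h := CompactSpace.iInter_nonempty (t := fun i => range (T i))
    (fun i => (isCompact_range (hT i)).isClosed) (fun s => by
      obtain ⟨S, hS, -⟩ := hfin s
      obtain ⟨p⟩ := ‹Nonempty P›
      exact ⟨S p, mem_iInter₂.2 fun i hi => hS i hi ⟨p, rfl⟩⟩)
  obtain ⟨p, hp⟩ := h
  exact ⟨p, fun i => mem_iInter.1 hp i⟩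

variable {G : Type u} {X : Type v} [CommGroup G] [MetricSpace X] [MulAction G X]
  [ContinuousConstSMul G X] [MeasurableSpace X] [BorelSpace X]

theorem measurable_const_smul_of_continuous (g : G) : Measurable (fun x : X => g • x) :=
  (continuous_const_smul g).measurable

/-- The average of the images of a measure under `1, g, …, g ^ n`. -/
noncomputable def orbitAverage (g : G) (n : ℕ) (μ : ProbabilityMeasure X) :
    ProbabilityMeasure X :=
  ⟨((n : ℝ≥0∞) + 1)⁻¹ • ∑ k ∈ Finset.range (n + 1),
      (μ : Measure X).map (fun x => g ^ k • x), ⟨by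
    simp only [Measure.smul_apply, Measure.finsetSum_apply, smul_eq_mul,
      Measure.map_apply (measurable_const_smul_of_continuous _) MeasurableSet.univ, preimage_univ,
      measure_univ, Finset.sum_const, Finset.card_range, nsmul_eq_mul, mul_one]
    push_cast
    exact ENNReal.inv_mul_cancel (by simp) (by simp)⟩⟩

theorem orbitAverage_apply (g : G) (n : ℕ) (μ : ProbabilityMeasure X) {s : Set X}
    (hs : MeasurableSet s) : (orbitAverage g n μ : Measure X) s = ((n : ℝ≥0∞) + 1)⁻¹ *
      ∑ k ∈ Finset.range (n + 1), (μ : Measure X) ((fun x => g ^ k • x) ⁻¹' s) := by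
  simp only [orbitAverage, ProbabilityMeasure.coe_mk, Measure.smul_apply,
    Measure.finsetSum_apply, smul_eq_mul,
    Measure.map_apply (measurable_const_smul_of_continuous _) hs]

theorem continuous_orbitAverage (g : G) (n : ℕ) :
    Continuous (orbitAverage g n : ProbabilityMeasure X → ProbabilityMeasure X) := by
  rw [ProbabilityMeasure.continuous_iff_forall_continuous_lintegral]
  intro f
  simp only [orbitAverage, ProbabilityMeasure.coe_mk, lintegral_smul_measure,
    lintegral_finsetSum_measure]
  refine (ENNReal.continuous_const_mul (by simp)).comp (continuous_finsetSum _ fun k _ => ?_)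
  have hk : Continuous (fun x : X => g ^ k • x) := continuous_const_smul _
  have : ∀ μ : ProbabilityMeasure X,
      ∫⁻ x, f x ∂(μ : Measure X).map (fun x => g ^ k • x) =
        ∫⁻ x, (f.compContinuous ⟨_, hk⟩) x ∂(μ : Measure X) := fun μ =>
    lintegral_map (f.continuous.measurable.coe_nnreal_ennreal) hk.measurable
  simp only [this]
  exact ProbabilityMeasure.continuous_lintegral_boundedContinuousFunction _

/-- Both composites average over the translates by g ^ i * h ^ j; this is where commutativity of G
enters. -/
theorem orbitAverage_commute (g h : G) (n l : ℕ) :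
    Function.Commute (orbitAverage g n : ProbabilityMeasure X → ProbabilityMeasure X)
      (orbitAverage h l) := by
  intro μ
  apply ProbabilityMeasure.eq_of_forall_toMeasure_apply_eq
  intro s hs
  rw [orbitAverage_apply _ _ _ hs, orbitAverage_apply _ _ _ hs]
  simp only [orbitAverage_apply _ _ _ (measurable_const_smul_of_continuous _ hs),
    ← Finset.mul_sum]
  rw [Finset.sum_comm, mul_left_comm]
  simp only [← preimage_comp, Function.comp_def, smul_smul, mul_comm]

/-- An abelian group acting on a non-empty compact metric space by homeomorphisms preserves a
Borel probability measure. -/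
theorem exists_invariant_probabilityMeasure [CompactSpace X] [Nonempty X] :
    ∃ μ : ProbabilityMeasure X, SMulInvariantMeasure G X (μ : Measure X) := by
  have : Nonempty (ProbabilityMeasure X) :=
    ⟨⟨Measure.dirac (Classical.arbitrary X), inferInstance⟩⟩
  obtain ⟨μ, hμ⟩ := exists_forall_mem_range_of_commute
    (fun i : G × ℕ => (orbitAverage i.1 i.2 : ProbabilityMeasure X → ProbabilityMeasure X))
    (fun i => continuous_orbitAverage _ _) (fun i j => orbitAverage_commute _ _ _ _)
  have hle : ∀ (g : G) (s : Set X), MeasurableSet s →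
      (μ : Measure X) ((fun x => g • x) ⁻¹' s) ≤ (μ : Measure X) s := by
    intro g s hs
    -- Writing μ as the n-th average of some ν makes both sides telescoping sums, which differ only
    -- in their end terms, each of weight 1 / (n + 1).
    have hn : ∀ n : ℕ, (μ : Measure X) ((fun x => g • x) ⁻¹' s) ≤
        (μ : Measure X) s + ((n : ℝ≥0∞) + 1)⁻¹ := by
      intro n
      obtain ⟨ν, hν⟩ := hμ (g, n)
      rw [← hν, orbitAverage_apply _ _ _ hs,
        orbitAverage_apply _ _ _ (measurable_const_smul_of_continuous _ hs)]
      simp only [← preimage_comp, Function.comp_def, smul_smul, ← pow_succ']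
      rw [Finset.sum_range_succ, Finset.sum_range_succ' _ n, mul_add, mul_add]
      have h1 : (ν : Measure X) ((fun x => g ^ (n + 1) • x) ⁻¹' s) ≤ 1 := prob_le_one
      calc _ ≤ ((n : ℝ≥0∞) + 1)⁻¹ * ∑ k ∈ Finset.range n,
                (ν : Measure X) ((fun x => g ^ (k + 1) • x) ⁻¹' s) + ((n : ℝ≥0∞) + 1)⁻¹ * 1 := by
              gcongr
        _ ≤ _ := by
              rw [mul_one]
              gcongr
              exact le_self_add
    have hlim : Filter.Tendsto (fun n : ℕ => (μ : Measure X) s + ((n : ℝ≥0∞) + 1)⁻¹) Filter.atTop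
        (𝓝 ((μ : Measure X) s + 0)) := by
      refine Filter.Tendsto.add tendsto_const_nhds ?_
      have := (Filter.tendsto_add_atTop_iff_nat 1).2 ENNReal.tendsto_inv_nat_nhds_zero
      simpa using this
    rw [add_zero] at hlim
    exact ge_of_tendsto' hlim hn
  refine ⟨μ, ⟨fun g s hs => le_antisymm (hle g s hs) ?_⟩⟩
  -- The reverse inequality is `hle` for g⁻¹ applied to the preimage of s.
  have h := hle g⁻¹ _ (measurable_const_smul_of_continuous g hs)
  rwa [← preimage_comp, show ((fun x : X => g • x) ∘ fun x => g⁻¹ • x) = id from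
    funext fun x => smul_inv_smul g x, preimage_id] at h

end InvariantMeasure

/-! ### Invariant pseudometrics and the equicontinuous structure relation. -/

section InvariantPseudometric

variable {G : Type u} {X : Type v} [Group G] [TopologicalSpace G] [MetricSpace X]
  [CompactSpace X] [MulAction G X] [ContinuousSMul G X]

/-- A continuous equivariant surjection onto a pseudometric space with an isometric action does
not separate points of the equicontinuous structure relation. -/
theorem EqRel.dist_eq_zero {x y : X} (h : EqRel G X x y) {Z : Type v} [PseudoMetricSpace Z]
    [MulAction G Z] [IsIsometricSMul G Z] {f : X → Z} (hf : IsFactorMap G f) :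
    dist (f x) (f y) = 0 := by
  have : CompactSpace Z := hf.surjective.compactSpace hf.continuous
  have : ContinuousSMul G Z := by
    refine ⟨continuous_iff_continuousAt.2 ?_⟩
    rintro ⟨g₀, z₀⟩
    obtain ⟨x₀, rfl⟩ := hf.surjective z₀
    -- As the action on Z is isometric, joint continuity reduces to continuity of the orbit map of f
    -- x₀, which is inherited from X.
    have hle : ∀ p : G × Z, dist (p.1 • p.2) (g₀ • f x₀) ≤
        dist p.2 (f x₀) + dist (f (p.1 • x₀)) (f (g₀ • x₀)) := fun p => by
      rw [hf.map_smul, hf.map_smul, ← dist_smul p.1 p.2 (f x₀)]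
      exact dist_triangle _ _ _
    have hc : Continuous fun p : G × Z =>
        dist p.2 (f x₀) + dist (f (p.1 • x₀)) (f (g₀ • x₀)) :=
      (continuous_snd.dist continuous_const).add
        ((hf.continuous.comp (continuous_fst.smul continuous_const)).dist continuous_const)
    have h0 := hc.tendsto (g₀, f x₀)
    simp only [dist_self, add_zero] at h0
    exact tendsto_iff_dist_tendsto_zero.2 (squeeze_zero (fun _ => dist_nonneg) hle h0)
  have hmk : IsFactorMap G (SeparationQuotient.mk ∘ f : X → SeparationQuotient Z) :=
    { surjective := SeparationQuotient.surjective_mk.comp hf.surjective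
      continuous := SeparationQuotient.continuous_mk.comp hf.continuous
      map_smul := fun g x => congrArg SeparationQuotient.mk (hf.map_smul g x) }
  have hequi : EquicontinuousAction G (SeparationQuotient Z) := by
    intro ε hε
    refine ⟨ε, hε, fun a b hab g => ?_⟩
    obtain ⟨a, rfl⟩ := SeparationQuotient.surjective_mk a
    obtain ⟨b, rfl⟩ := SeparationQuotient.surjective_mk b
    rw [← SeparationQuotient.mk_smul, ← SeparationQuotient.mk_smul, SeparationQuotient.dist_mk,
      dist_smul]
    rwa [SeparationQuotient.dist_mk] at hab
  have : CompactSpace (SeparationQuotient Z) := hmk.surjective.compactSpace hmk.continuous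
  have := h _ hequi _ hmk
  rw [← SeparationQuotient.dist_mk]
  exact _root_.dist_eq_zero.2 this

/-- Continuous invariant pseudometrics vanish on the equicontinuous structure relation. -/
theorem EqRel.eq_zero_of_invariant {x y : X} (h : EqRel G X x y) {D : X → X → ℝ}
    (hrefl : ∀ a, D a a = 0) (hsymm : ∀ a b, D a b = D b a)
    (htri : ∀ a b c, D a c ≤ D a b + D b c) (hinv : ∀ (g : G) a b, D (g • a) (g • b) = D a b)
    (hcont : ∀ a, Filter.Tendsto (fun b => D b a) (𝓝 a) (𝓝 0)) : D x y = 0 := by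
  -- An opaque copy of X carries the pseudometric D, so that it does not clash with the given
  -- metric.
  obtain ⟨Z, ⟨e⟩⟩ : ∃ Z : Type v, Nonempty (X ≃ Z) := ⟨X, ⟨Equiv.refl X⟩⟩
  let _ : PseudoMetricSpace Z :=
    { dist := fun a b => D (e.symm a) (e.symm b)
      dist_self := fun a => hrefl _
      dist_comm := fun a b => hsymm _ _
      dist_triangle := fun a b c => htri _ _ _ }
  let _ : MulAction G Z := e.symm.mulAction G
  have hsmul : ∀ (g : G) (a : X), e (g • a) = g • e a := fun g a => by
    simp [Equiv.smul_def]
  have hdist : ∀ a b : X, dist (e a) (e b) = D a b := fun a b => by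
    change D (e.symm (e a)) (e.symm (e b)) = _
    simp
  have : IsIsometricSMul G Z := ⟨fun g => Isometry.of_dist_eq fun a b => by
    obtain ⟨a, rfl⟩ := e.surjective a
    obtain ⟨b, rfl⟩ := e.surjective b
    rw [← hsmul, ← hsmul, hdist, hdist, hinv]⟩
  have hf : IsFactorMap G e :=
    { surjective := e.surjective
      continuous := continuous_iff_continuousAt.2 fun a =>
        tendsto_iff_dist_tendsto_zero.2 (by simpa only [hdist] using hcont a)
      map_smul := hsmul }
  rw [← hdist]
  exact h.dist_eq_zero hf

end InvariantPseudometric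

/-! ### Measures of the sections of a closed invariant set. -/

section Sections

open MeasureTheory
open scoped ENNReal symmDiff

/-- Sections of a closed set over a compact space depend upper semicontinuously on the point. -/
theorem eventually_section_subset {X Y : Type*} [TopologicalSpace X] [TopologicalSpace Y]
    [CompactSpace Y] {N : Set (X × Y)} (hN : IsClosed N) {O : Set Y} (hO : IsOpen O) {x₀ : X}
    (h : Prod.mk x₀ ⁻¹' N ⊆ O) : ∀ᶠ x in 𝓝 x₀, Prod.mk x ⁻¹' N ⊆ O := by
  have hc : IsClosed (Prod.fst '' (N ∩ Prod.snd ⁻¹' Oᶜ)) :=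
    isClosedMap_fst_of_compactSpace _ (hN.inter (hO.isClosed_compl.preimage continuous_snd))
  have hx : x₀ ∉ Prod.fst '' (N ∩ Prod.snd ⁻¹' Oᶜ) := by
    rintro ⟨⟨a, b⟩, ⟨hab, hb⟩, rfl⟩
    exact hb (h hab)
  filter_upwards [hc.isOpen_compl.mem_nhds hx] with x hx v hv
  by_contra hvO
  exact hx ⟨(x, v), ⟨hv, hvO⟩, rfl⟩

theorem section_smul {G X Y : Type*} [Group G] [MulAction G X] [MulAction G Y] {N : Set (X × Y)}
    (hinv : ∀ g : G, ∀ p ∈ N, g • p ∈ N) (g : G) (x : X) :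
    Prod.mk (g • x) ⁻¹' N = (fun v => g⁻¹ • v) ⁻¹' (Prod.mk x ⁻¹' N) := by
  ext v
  simp only [mem_preimage]
  constructor
  · intro h
    simpa using hinv g⁻¹ _ h
  · intro h
    simpa using hinv g _ h

variable {G : Type u} {X : Type v} {Y : Type*} [Group G] [MetricSpace X] [MulAction G X]
  [MetricSpace Y] [CompactSpace Y] [MulAction G Y]
  [MeasurableSpace Y] [BorelSpace Y] (μ : Measure Y) [IsFiniteMeasure μ]
  [SMulInvariantMeasure G Y μ] {N : Set (X × Y)}

/-- By outer regularity and upper semicontinuity, sections near x' have measure less than any r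
above that of the section at x'. Minimality moves x near x', and invariance of μ leaves the measure
of its section unchanged. -/
theorem measure_section_le (hN : IsClosed N) (hinv : ∀ g : G, ∀ p ∈ N, g • p ∈ N)
    [MulAction.IsMinimal G X] (x x' : X) : μ (Prod.mk x ⁻¹' N) ≤ μ (Prod.mk x' ⁻¹' N) := by
  refine le_of_forall_gt fun r hr => ?_
  obtain ⟨O, hsub, hO, hlt⟩ := Set.exists_isOpen_lt_of_lt _ r hr
  obtain ⟨U, hU, hUo, hxU⟩ := eventually_nhds_iff.1 (eventually_section_subset hN hO hsub)
  obtain ⟨g, hg⟩ := hUo.exists_smul_mem G x ⟨x', hxU⟩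
  have := hU _ hg
  rw [section_smul hinv] at this
  refine lt_of_le_of_lt ?_ hlt
  rw [← measure_preimage_smul μ g⁻¹ (Prod.mk x ⁻¹' N)]
  exact measure_mono this

theorem measure_section_eq (hN : IsClosed N) (hinv : ∀ g : G, ∀ p ∈ N, g • p ∈ N)
    [MulAction.IsMinimal G X] (x x' : X) : μ (Prod.mk x ⁻¹' N) = μ (Prod.mk x' ⁻¹' N) :=
  le_antisymm (measure_section_le μ hN hinv x x') (measure_section_le μ hN hinv x' x)

/-- Near x₀ both sections lie in an open set barely larger than the section at x₀. Since they have
equal measure, each of the two differences is as small as that excess; an excess of ε / 4 gives at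
most ε / 2. -/
theorem tendsto_measureReal_section_symmDiff (hN : IsClosed N)
    (hinv : ∀ g : G, ∀ p ∈ N, g • p ∈ N) [MulAction.IsMinimal G X] (x₀ : X) :
    Filter.Tendsto (fun x => μ.real ((Prod.mk x ⁻¹' N) ∆ (Prod.mk x₀ ⁻¹' N))) (𝓝 x₀) (𝓝 0) := by
  have hcl : ∀ x : X, MeasurableSet (Prod.mk x ⁻¹' N) := fun x =>
    (hN.preimage (Continuous.prodMk_right x)).measurableSet
  rw [Metric.tendsto_nhds]
  intro ε hε
  have hε' : ENNReal.ofReal (ε / 4) ≠ 0 := by simpa using hε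
  obtain ⟨O, hsub, hO, hlt⟩ :=
    Set.exists_isOpen_lt_add (Prod.mk x₀ ⁻¹' N) (measure_ne_top μ _) hε'
  filter_upwards [eventually_section_subset hN hO hsub] with x hx
  have hle : μ.real O ≤ μ.real (Prod.mk x₀ ⁻¹' N) + ε / 4 := by
    have := ENNReal.toReal_mono (by finiteness) hlt.le
    rwa [ENNReal.toReal_add (by finiteness) (by finiteness),
      ENNReal.toReal_ofReal (by positivity)] at this
  have heq : μ.real (Prod.mk x ⁻¹' N) = μ.real (Prod.mk x₀ ⁻¹' N) :=
    congrArg ENNReal.toReal (measure_section_eq μ hN hinv x x₀)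
  have h1 : μ.real (Prod.mk x ⁻¹' N ∪ Prod.mk x₀ ⁻¹' N) ≤ μ.real O :=
    measureReal_mono (union_subset hx hsub)
  have h2 := measureReal_union_add_inter (μ := μ) (s := Prod.mk x ⁻¹' N) (hcl x₀)
  have h3 := measureReal_sdiff_add_inter (μ := μ) (s := Prod.mk x ⁻¹' N) (hcl x₀)
  have h4 := measureReal_sdiff_add_inter (μ := μ) (s := Prod.mk x₀ ⁻¹' N) (hcl x)
  rw [inter_comm] at h4
  rw [Real.dist_eq, sub_zero, abs_of_nonneg measureReal_nonneg,
    measureReal_symmDiff_eq (hcl x) (hcl x₀)]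
  linarith

/-- The sections of a closed invariant set over points of the equicontinuous structure relation
agree almost everywhere, hence contain the same open sets. -/
theorem EqRel.subset_section [TopologicalSpace G] [CompactSpace X] [ContinuousSMul G X]
    [MulAction.IsMinimal G X] [μ.IsOpenPosMeasure] {x x' : X} (h : EqRel G X x x')
    (hN : IsClosed N) (hinv : ∀ g : G, ∀ p ∈ N, g • p ∈ N) {V : Set Y} (hV : IsOpen V)
    (hVN : V ⊆ Prod.mk x ⁻¹' N) : V ⊆ Prod.mk x' ⁻¹' N := by
  have hcl : ∀ x : X, IsClosed (Prod.mk x ⁻¹' N) := fun x =>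
    hN.preimage (Continuous.prodMk_right x)
  have h0 := h.eq_zero_of_invariant
    (D := fun a b => μ.real ((Prod.mk a ⁻¹' N) ∆ (Prod.mk b ⁻¹' N)))
    (fun a => by simp) (fun a b => by rw [symmDiff_comm])
    (fun a b c => measureReal_symmDiff_le _)
    (fun g a b => by
      simp only [section_smul hinv, ← preimage_symmDiff, Measure.real]
      rw [measure_preimage_smul])
    (tendsto_measureReal_section_symmDiff μ hN hinv)
  -- The part of V outside the closed section at x' is open and null, hence empty by full support.
  have h1 : μ (V \ Prod.mk x' ⁻¹' N) = 0 := by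
    refine measure_mono_null ?_ ((measureReal_eq_zero_iff).1 h0)
    exact fun v hv => Or.inl ⟨hVN hv.1, hv.2⟩
  have h2 := (hV.sdiff (hcl x')).eq_empty_of_measure_zero h1
  exact sdiff_eq_empty.1 h2

end Sections

/-! ### Closed invariant sets of tuples, generic fibres and transport between fibres. -/

section Tuples

open MeasureTheory

variable {G : Type u} {X : Type v} [CommGroup G] [TopologicalSpace G] [MetricSpace X]
  [CompactSpace X] [MulAction G X] [ContinuousSMul G X] [MulAction.IsMinimal G X]

theorem piEq_eq_iff {G : Type u} {X : Type v} [Group G] [TopologicalSpace G] [MetricSpace X]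
    [MulAction G X] {x y : X} : piEq G X x = piEq G X y ↔ EqRel G X x y :=
  Quotient.eq (r := eqSetoid G X)

/-- A closed invariant set of tuples which contains `{update v i a | v ∈ V}` for an open set `V`
also contains `{update v i b | v ∈ V}` whenever `a` and `b` lie in the same fibre of `π_eq`. -/
theorem EqRel.update_mem {ι : Type} [Fintype ι] [DecidableEq ι] {a b : X} (h : EqRel G X a b)
    {N : Set (ι → X)} (hN : IsClosed N) (hinv : ∀ g : G, ∀ x ∈ N, g • x ∈ N) (i : ι)
    {V : Set (ι → X)} (hV : IsOpen V) (hVN : ∀ v ∈ V, Function.update v i a ∈ N) :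
    ∀ v ∈ V, Function.update v i b ∈ N := by
  have : Nonempty X := ⟨a⟩
  let _ : MeasurableSpace X := borel X
  have : BorelSpace X := ⟨rfl⟩
  obtain ⟨μ, hμ⟩ := exists_invariant_probabilityMeasure (G := G) (X := X)
  -- Minimality forces full support: finitely many translates of a non-empty open set cover X.
  have hpos : (μ : Measure X).IsOpenPosMeasure :=
    ⟨fun U hU hne => (measure_isOpen_pos_of_smulInvariant_of_ne_zero G
      (IsProbabilityMeasure.ne_zero (μ : Measure X)) hU hne).ne'⟩
  have hpi : SMulInvariantMeasure G (ι → X) (Measure.pi fun _ => (μ : Measure X)) := by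
    refine ⟨fun g s hs => ?_⟩
    have h1 : Measurable fun x : X => g • x := measurable_const_smul_of_continuous g
    have h2 := Measure.pi_map_pi (μ := fun _ : ι => (μ : Measure X)) (f := fun _ x => g • x)
      (fun _ => h1.aemeasurable)
    have h3 : (μ : Measure X).map (fun x => g • x) = μ := Measure.ext fun t ht => by
      rw [Measure.map_apply h1 ht, measure_preimage_smul]
    simp only [h3] at h2
    conv_rhs => rw [← h2]
    have h4 : Measurable fun (x : ι → X) i => g • x i :=
      measurable_pi_lambda _ fun j => h1.comp (measurable_pi_apply j)
    rw [Measure.map_apply h4 hs]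
    rfl
  -- The pair (a, v) stands for v with i-th entry replaced by a. The old entry of v is a dummy,
  -- which lets the full power of X serve as second factor.
  have hcont : Continuous fun p : X × (ι → X) => Function.update p.2 i p.1 :=
    continuous_snd.update i continuous_fst
  refine h.subset_section (Measure.pi fun _ => (μ : Measure X)) (hN.preimage hcont) ?_ hV hVN
  intro g p hp
  have : Function.update (g • p).2 i (g • p).1 = g • Function.update p.2 i p.1 := by
    ext j
    rcases eq_or_ne j i with rfl | hj <;> simp [*]
  rw [mem_preimage, this]
  exact hinv g _ hp

/-- The interior of the `π_eq`-saturation of a set. -/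
def saturationInterior (G : Type u) {X : Type v} [Group G] [TopologicalSpace G] [MetricSpace X]
    [MulAction G X] (A : Set X) : Set X :=
  interior (piEq G X ⁻¹' (piEq G X '' A))

/-- If a closed invariant set of tuples contains an open box, it contains the box of the
interiors of the saturations of its sides. -/
theorem pi_saturationInterior_subset {ι : Type} [Fintype ι]
    {N : Set (ι → X)} (hN : IsClosed N) (hinv : ∀ g : G, ∀ x ∈ N, g • x ∈ N) {A : ι → Set X}
    (hA : ∀ i, IsOpen (A i)) (hAN : pi univ A ⊆ N) :
    pi univ (fun i => saturationInterior G (A i)) ⊆ N := by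
  classical
  have key : ∀ s : Finset ι,
      pi univ (fun i => if i ∈ s then saturationInterior G (A i) else A i) ⊆ N := by
    intro s
    induction s using Finset.induction_on with
    | empty => simpa using hAN
    | insert i s his ih =>
      intro x hx
      have hxi : x i ∈ saturationInterior G (A i) := by simpa using hx i (mem_univ i)
      obtain ⟨a, ha, hax⟩ := interior_subset hxi
      have hopen : IsOpen (pi univ fun i => if i ∈ s then saturationInterior G (A i) else A i) :=
        isOpen_set_pi finite_univ fun j _ => by
          split_ifs
          · exact isOpen_interior
          · exact hA j
      have hcont : Continuous fun v : ι → X => Function.update v i a :=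
        continuous_id.update i continuous_const
      -- The entry x i is first replaced by a point a of A i in the same fibre, where the induction
      -- hypothesis applies, and then restored.
      have := (piEq_eq_iff.1 hax).update_mem hN hinv i (hopen.preimage hcont)
        (fun v hv => ih hv) x (by
          intro j _
          rcases eq_or_ne j i with rfl | hj
          · simpa [his] using ha
          · simpa [hj] using hx j (mem_univ j))
      rwa [Function.update_eq_self] at this
  simpa using key Finset.univ

/-- There is a fibre of `π_eq` all of whose points have neighbourhoods with images that are
neighbourhoods. -/
theorem exists_fibre_subset_saturationInterior (G : Type u) (X : Type v) [Group G]
    [TopologicalSpace G] [MetricSpace X] [CompactSpace X] [MulAction G X] [Nonempty X] :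
    ∃ y : MaxEqFactor G X, ∀ z, piEq G X z = y → ∀ A ∈ 𝓝 z, ∀ w, piEq G X w = y →
      w ∈ saturationInterior G A := by
  obtain ⟨B, hBc, -, hB⟩ := TopologicalSpace.exists_countable_basis X
  have hπ := isFactorMap_piEq G X
  have hcl : ∀ U : Set X, IsClosed (piEq G X '' closure U) := fun U =>
    isClosedMap_piEq G X _ isClosed_closure
  have : Nonempty (MaxEqFactor G X) := ⟨piEq G X (Classical.arbitrary X)⟩
  -- Frontiers of closed sets are nowhere dense, so by Baire some y avoids the frontiers of the
  -- images of all basic closures. If such an image contains y, it is a neighbourhood of y.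
  have hdense := dense_biInter_of_isOpen (S := B)
    (f := fun U => (frontier (piEq G X '' closure U))ᶜ)
    (fun U _ => isClosed_frontier.isOpen_compl) hBc (fun U _ => by
      rw [← interior_eq_empty_iff_dense_compl]
      exact interior_frontier (hcl U))
  obtain ⟨y, hy⟩ := hdense.nonempty
  refine ⟨y, fun z hz A hA w hw => ?_⟩
  obtain ⟨C, hC, hCcl, hCA⟩ := exists_mem_nhds_isClosed_subset hA
  obtain ⟨U, hU, hzU, hUC⟩ := hB.mem_nhds_iff.1 hC
  have hUA : closure U ⊆ A := (closure_minimal hUC hCcl).trans hCA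
  have hyU : y ∈ interior (piEq G X '' closure U) := by
    by_contra hyi
    exact mem_iInter₂.1 hy U hU
      ⟨subset_closure ⟨z, subset_closure hzU, hz⟩, hyi⟩
  refine mem_interior.2 ⟨piEq G X ⁻¹' interior (piEq G X '' closure U), ?_,
    isOpen_interior.preimage hπ.continuous, ?_⟩
  · exact preimage_mono (interior_subset.trans (image_mono hUA))
  · rwa [mem_preimage, hw]

/-- A tuple in one fibre of `π_eq` which stays `δ`-separated along the action can be moved to any
other fibre. -/
theorem exists_separated_tuple_in_fibre {ι : Type} [Nonempty ι] {δ : ℝ}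
    {z : ι → X} (hz : ∀ i j, piEq G X (z i) = piEq G X (z j))
    (hsep : ∀ i j, i ≠ j → ∀ g : G, δ ≤ dist (g • z i) (g • z j)) (y : MaxEqFactor G X) :
    ∃ z' : ι → X, (∀ i, piEq G X (z' i) = y) ∧
      ∀ i j, i ≠ j → ∀ g : G, δ ≤ dist (g • z' i) (g • z' j) := by
  have hπ := isFactorMap_piEq G X
  let S : Set (ι → X) := {z | (∀ i j, piEq G X (z i) = piEq G X (z j)) ∧
    ∀ i j, i ≠ j → ∀ g : G, δ ≤ dist (g • z i) (g • z j)}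
  have hS : IsClosed S := by
    simp only [S, ofPred_and, ofPred_forall]
    refine IsClosed.inter ?_ ?_
    · exact isClosed_iInter fun i => isClosed_iInter fun j => isClosed_eq
        (hπ.continuous.comp (continuous_apply i)) (hπ.continuous.comp (continuous_apply j))
    · exact isClosed_iInter fun i => isClosed_iInter fun j => isClosed_iInter fun _ =>
        isClosed_iInter fun g => isClosed_le continuous_const
          (((continuous_apply i).const_smul g).dist ((continuous_apply j).const_smul g))
  obtain ⟨i₀⟩ := ‹Nonempty ι›
  let p : (ι → X) → MaxEqFactor G X := fun z => piEq G X (z i₀)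
  have hp : Continuous p := hπ.continuous.comp (continuous_apply i₀)
  have hcl : IsClosed (piEq G X ⁻¹' (p '' S)) :=
    (hp.isClosedMap _ hS).preimage hπ.continuous
  have hinv : ∀ g : G, g • (piEq G X ⁻¹' (p '' S)) ⊆ piEq G X ⁻¹' (p '' S) := by
    rintro g _ ⟨x, ⟨z, hz, hzx⟩, rfl⟩
    refine ⟨g • z, ⟨fun i j => ?_, fun i j hij k => ?_⟩, ?_⟩
    · simp only [Pi.smul_apply, hπ.map_smul, hz.1 i j]
    · simpa only [Pi.smul_apply, smul_smul] using hz.2 i j hij (k * g)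
    · change piEq G X (g • z i₀) = piEq G X (g • x)
      rw [hπ.map_smul, hπ.map_smul]
      exact congrArg _ hzx
  obtain ⟨x, rfl⟩ := hπ.surjective y
  -- The fibres carrying a tuple from S form a closed invariant set; it is pulled back to X, where
  -- minimality is assumed.
  rcases eq_empty_or_univ_of_smul_invariant_closed G hcl hinv with h | h
  · exact absurd (show z i₀ ∈ piEq G X ⁻¹' (p '' S) from ⟨z, ⟨hz, hsep⟩, rfl⟩) (by simp [h])
  · obtain ⟨z', hz', hx⟩ : x ∈ piEq G X ⁻¹' (p '' S) := h ▸ mem_univ x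
    exact ⟨z', fun i => (hz'.1 i i₀).trans hx, hz'.2⟩

end Tuples

/-! ### The implications between sensitivity, regional proximality and coincidence rank. -/

section Equivalence

theorem not_isProximalPair_iff {G : Type u} {X : Type v} [Group G] [MetricSpace X] [MulAction G X]
    {x y : X} : ¬ IsProximalPair G x y ↔ ∃ δ : ℝ, 0 < δ ∧ ∀ g : G, δ ≤ dist (g • x) (g • y) := by
  simp [IsProximalPair]

/-- Regionally proximal pairs are identified by every equicontinuous factor. -/
theorem IsRegionallyProximal.eqRel {G : Type u} {X : Type v} [Group G] [TopologicalSpace G]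
    [MetricSpace X] [CompactSpace X] [MulAction G X] {x y : X}
    (h : IsRegionallyProximal G ![x, y]) : EqRel G X x y := by
  intro Y _ _ _ _ hY φ hφ
  refine _root_.eq_of_forall_dist_le fun η hη => ?_
  obtain ⟨δ, hδ, hYδ⟩ := hY (η / 3) (by positivity)
  have hu := CompactSpace.uniformContinuous_of_continuous hφ.continuous
  obtain ⟨ε, hε, hφε⟩ := Metric.uniformContinuous_iff.1 hu (min δ (η / 3)) (by positivity)
  obtain ⟨x', hx', g, hg⟩ := h ε hε
  have h0 : dist (φ x) (φ (x' 0)) < η / 3 := (hφε (hx' 0)).trans_le (min_le_right _ _)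
  have h1 : dist (φ y) (φ (x' 1)) < η / 3 := (hφε (hx' 1)).trans_le (min_le_right _ _)
  have h2 : dist (φ (x' 0)) (φ (x' 1)) < η / 3 := by
    have := hYδ _ _ ((hφε (hg 0 1)).trans_le (min_le_left _ _)) g⁻¹
    simpa only [hφ.map_smul, inv_smul_smul] using this
  have h3 := dist_triangle4 (φ x) (φ (x' 0)) (φ (x' 1)) (φ y)
  rw [dist_comm (φ (x' 1))] at h3
  linarith

theorem IsRegionallyProximal.smul {G : Type u} {X : Type v} [Group G] [MetricSpace X]
    [CompactSpace X] [MulAction G X] [ContinuousConstSMul G X] {m : ℕ} {x : Fin m → X}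
    (h : IsRegionallyProximal G x) (g : G) : IsRegionallyProximal G (g • x) := by
  intro ε hε
  have hu := CompactSpace.uniformContinuous_of_continuous (continuous_const_smul (T := X) g)
  obtain ⟨δ, hδ, hgδ⟩ := Metric.uniformContinuous_iff.1 hu ε hε
  obtain ⟨x', hx', k, hk⟩ := h (min δ ε) (by positivity)
  refine ⟨g • x', fun i => hgδ ((hx' i).trans_le (min_le_left _ _)), k * g⁻¹, fun i j => ?_⟩
  simpa [mul_smul] using (hk i j).trans_le (min_le_right _ _)

variable {G : Type u} {X : Type v} [CommGroup G] [TopologicalSpace G] [MetricSpace X]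
  [MulAction G X] {m : ℕ}

/-- Sensitivity on balls shrinking to a point x₀, with compact sets exhausting G, gives tuples whose
translates k n • x n subconverge to z. Applying (k n)⁻¹ brings these translates back near x₀, whence
regional proximality. Every g lies in all late compact sets, so separation passes to the limit. -/
theorem CompactlySensitive.exists_separated_regionallyProximal [SigmaCompactSpace G]
    [CompactSpace X] [ContinuousSMul G X] [Nonempty X]
    (h : CompactlySensitive G X m) : ∃ ε : ℝ, 0 < ε ∧ ∃ z : Fin m → X,
      (∀ i j, IsRegionallyProximal G ![z i, z j]) ∧
      ∀ i j, i ≠ j → ∀ g : G, ε ≤ dist (g • z i) (g • z j) := by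
  obtain ⟨ε, hε, H⟩ := h
  obtain ⟨x₀⟩ := ‹Nonempty X›
  have H' := fun n : ℕ => H (Metric.ball x₀ (1 / (n + 1))) Metric.isOpen_ball
    ⟨x₀, Metric.mem_ball_self (by positivity)⟩ (compactCovering G n) (isCompact_compactCovering G n)
  choose x hx k hk using H'
  obtain ⟨z, φ, hφ, hlim⟩ := CompactSpace.tendsto_subseq fun n => k n • x n
  have hlimi : ∀ i, Filter.Tendsto (fun n => k (φ n) • x (φ n) i) Filter.atTop (𝓝 (z i)) :=
    fun i => tendsto_pi_nhds.1 hlim i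
  refine ⟨ε, hε, z, fun i j δ hδ => ?_, fun i j hij g => ?_⟩
  · have hsmall := (tendsto_one_div_add_atTop_nhds_zero_nat (𝕜 := ℝ)).comp hφ.tendsto_atTop
    obtain ⟨n, hni, hnj, hn⟩ := ((Metric.tendsto_nhds.1 (hlimi i) δ hδ).and
      ((Metric.tendsto_nhds.1 (hlimi j) δ hδ).and
        (hsmall.eventually_lt_const (half_pos hδ)))).exists
    simp only [Function.comp_apply] at hn
    have hball : ∀ a b, dist (x (φ n) a) (x (φ n) b) < δ := fun a b => by
      have ha := Metric.mem_ball.1 (hx (φ n) a)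
      have hb := Metric.mem_ball'.1 (hx (φ n) b)
      have := dist_triangle (x (φ n) a) x₀ (x (φ n) b)
      linarith
    refine ⟨![k (φ n) • x (φ n) i, k (φ n) • x (φ n) j], fun a => ?_, (k (φ n))⁻¹, fun a b => ?_⟩
    · fin_cases a
      · simpa [dist_comm] using hni
      · simpa [dist_comm] using hnj
    · fin_cases a <;> fin_cases b <;> simp [hδ, hball]
  · obtain ⟨N, hN⟩ := exists_mem_compactCovering g
    refine ge_of_tendsto (((hlimi i).const_smul g).dist ((hlimi j).const_smul g)) ?_
    filter_upwards [Filter.eventually_ge_atTop N] with n hn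
    have hg : g ∈ compactCovering G (φ n) :=
      compactCovering_subset G (hn.trans (hφ.id_le n)) hN
    have := hk (φ n) (mul_mem_mul hg (mem_singleton _)) i j hij
    simpa only [mul_smul] using this.le

/-- A finite lower bound on the supremum is attained: tuples longer than m can be truncated, and
without an m-tuple the supremum is at most m - 1, which is smaller than m because m ≥ 1. -/
theorem exists_of_le_coincidenceRank {y : MaxEqFactor G X} (hm : 1 ≤ m)
    (h : (m : ℕ∞) ≤ coincidenceRank y) : ∃ x : Fin m → X, (∀ i, piEq G X (x i) = y) ∧
      ∀ i j, i ≠ j → ¬ IsProximalPair G (x i) (x j) := by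
  by_contra hno
  have hle : coincidenceRank y ≤ ((m - 1 : ℕ) : ℕ∞) := by
    refine sSup_le ?_
    rintro _ ⟨n, -, rfl, x, hx, hprox⟩
    by_contra hn
    have hmn : m ≤ n := by
      rw [Nat.cast_le] at hn
      omega
    exact hno ⟨fun i => x (Fin.castLE hmn i), fun i => hx _, fun i j hij =>
      hprox _ _ fun he => hij (Fin.castLE_injective hmn he)⟩
  have := Nat.cast_le.1 (h.trans hle)
  omega

theorem exists_separated_of_le_coincidenceRank {y : MaxEqFactor G X} (hm : 1 ≤ m)
    (h : (m : ℕ∞) ≤ coincidenceRank y) : ∃ δ : ℝ, 0 < δ ∧ ∃ x : Fin m → X,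
      (∀ i, piEq G X (x i) = y) ∧ ∀ i j, i ≠ j → ∀ g : G, δ ≤ dist (g • x i) (g • x j) := by
  obtain ⟨x, hx, hprox⟩ := exists_of_le_coincidenceRank hm h
  have hδ : ∀ p : Fin m × Fin m, ∃ δ : ℝ, 0 < δ ∧
      (p.1 ≠ p.2 → ∀ g : G, δ ≤ dist (g • x p.1) (g • x p.2)) := fun p => by
    by_cases hp : p.1 = p.2
    -- Diagonal pairs carry no condition; 1 is a filler that keeps the minimum over all pairs
    -- positive.
    · exact ⟨1, one_pos, fun h => absurd hp h⟩
    · obtain ⟨δ, hδ, h⟩ := not_isProximalPair_iff.1 (hprox _ _ hp)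
      exact ⟨δ, hδ, fun _ => h⟩
  choose δ hpos hδ using hδ
  have hne : Nonempty (Fin m × Fin m) := ⟨(⟨0, hm⟩, ⟨0, hm⟩)⟩
  obtain ⟨p₀, hp₀⟩ := Finite.exists_min δ
  exact ⟨δ p₀, hpos p₀, x, hx, fun i j hij g => (hp₀ (i, j)).trans (hδ (i, j) hij g)⟩

/-- A separated tuple z is placed in a generic fibre, and a box around it is chosen in which all
tuples stay δ / 2-separated along K. The orbit closure of the box contains a constant tuple, so a
translate of some tuple a of the box lies in U; undoing the translation before acting by K recovers
the separation of a. -/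
theorem CompactlySensitive.of_le_coincidenceRank [CompactSpace X] [ContinuousSMul G X]
    [MulAction.IsMinimal G X] {y : MaxEqFactor G X} (hm : 1 ≤ m)
    (h : (m : ℕ∞) ≤ coincidenceRank y) : CompactlySensitive G X m := by
  obtain ⟨δ, hδ, x, hx, hsep⟩ := exists_separated_of_le_coincidenceRank hm h
  have : Nonempty (Fin m) := ⟨⟨0, hm⟩⟩
  let i₀ : Fin m := ⟨0, hm⟩
  have : Nonempty X := ⟨x i₀⟩
  obtain ⟨y₀, hy₀⟩ := exists_fibre_subset_saturationInterior G X
  obtain ⟨z, hz, hzsep⟩ := exists_separated_tuple_in_fibre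
    (fun i j => (hx i).trans (hx j).symm) hsep y₀
  refine ⟨δ / 2, half_pos hδ, fun U hU hUne K hK => ?_⟩
  have hev : ∀ᶠ a in 𝓝 z, ∀ g ∈ K, ∀ i j, i ≠ j → δ / 2 < dist (g • a i) (g • a j) := by
    refine hK.eventually_forall_of_forall_eventually fun g _ => ?_
    simp only [Filter.eventually_all]
    intro i j hij
    have hc : Continuous fun p : (Fin m → X) × G => dist (p.2 • p.1 i) (p.2 • p.1 j) :=
      (continuous_snd.smul ((continuous_apply i).comp continuous_fst)).dist
        (continuous_snd.smul ((continuous_apply j).comp continuous_fst))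
    exact (hc.tendsto (z, g)).eventually_const_lt ((half_lt_self hδ).trans_le (hzsep i j hij g))
  obtain ⟨r, hr, hball⟩ := Metric.eventually_nhds_iff_ball.1 hev
  let A : Fin m → Set X := fun i => Metric.ball (z i) r
  let W : Set (Fin m → X) := ⋃ g : G, (fun a => g • a) '' pi univ A
  have hWinv : ∀ g : G, ∀ a ∈ closure W, g • a ∈ closure W := by
    intro g a ha
    refine map_mem_closure (continuous_const_smul g) ha ?_
    intro c hc
    obtain ⟨k, b, hb, rfl⟩ := mem_iUnion.1 hc
    exact mem_iUnion.2 ⟨g * k, b, hb, mul_smul g k b⟩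
  have hAW : pi univ A ⊆ closure W := fun a ha =>
    subset_closure (mem_iUnion.2 ⟨1, a, ha, one_smul G a⟩)
  have hsat := pi_saturationInterior_subset isClosed_closure hWinv
    (fun i => Metric.isOpen_ball) hAW
  -- All z i lie over y₀, so z i₀ lies in the saturation interior of each side of the box.
  have hdiag : (fun _ => z i₀ : Fin m → X) ∈ closure W := hsat fun i _ =>
    hy₀ (z i) (hz i) _ (Metric.ball_mem_nhds _ hr) _ (hz i₀)
  obtain ⟨g₀, hg₀⟩ := hU.exists_smul_mem G (z i₀) hUne
  have hO : IsOpen {a : Fin m → X | ∀ i, g₀ • a i ∈ U} := by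
    simp only [ofPred_forall]
    exact isOpen_iInter_of_finite fun i => hU.preimage ((continuous_apply i).const_smul g₀)
  obtain ⟨b, hbU, hb⟩ := mem_closure_iff.1 hdiag _ hO fun _ => hg₀
  obtain ⟨g, a, ha, rfl⟩ := mem_iUnion.1 hb
  -- With this h, acting by k * h on the chosen points gives k • a.
  refine ⟨g₀ • g • a, hbU, (g₀ * g)⁻¹, ?_⟩
  rintro _ ⟨k, hk, _, rfl, rfl⟩ i j hij
  have haz : a ∈ Metric.ball z r := by
    rw [ball_pi _ hr]
    exact ha
  simpa [mul_smul] using hball a haz k hk i j hij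

end Equivalence

end TopDyn

/-! ### The main theorem. -/

theorem mainTheorem2 (G : Type u) [CommGroup G] [TopologicalSpace G] [IsTopologicalGroup G]
    [LocallyCompactSpace G] [SigmaCompactSpace G]
    (X : Type v) [MetricSpace X] [CompactSpace X] [MulAction G X] [ContinuousSMul G X]
    [MulAction.IsMinimal G X] (m : ℕ) (hm : 2 ≤ m) (y : TopDyn.MaxEqFactor G X) :
    List.TFAE [
      TopDyn.CompactlySensitive G X m,
      ∃ δ : ℝ, 0 < δ ∧ ∀ U : Set X, IsOpen U → U.Nonempty →
        ∃ x : Fin m → X, x ⟨0, by omega⟩ ∈ U ∧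
          (∀ i j, TopDyn.IsRegionallyProximal G ![x i, x j]) ∧
          ∀ i j, i ≠ j → δ < ⨅ g : G, dist (g • x i) (g • x j),
      (m : ℕ∞) ≤ TopDyn.coincidenceRank y] := by
  obtain ⟨x₀, -⟩ := (TopDyn.isFactorMap_piEq G X).surjective y
  have : Nonempty X := ⟨x₀⟩
  tfae_have 1 → 2 := by
    intro h
    obtain ⟨ε, hε, z, hzQ, hz⟩ := h.exists_separated_regionallyProximal
    -- The limit tuple is only weakly ε-separated, so halving ε makes the bound on the infimum
    -- strict.
    refine ⟨ε / 2, half_pos hε, fun U hU hne => ?_⟩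
    obtain ⟨g, hg⟩ := hU.exists_smul_mem G (z ⟨0, by omega⟩) hne
    refine ⟨g • z, hg, fun i j => ?_, fun i j hij => ?_⟩
    · have := (hzQ i j).smul g
      rwa [Matrix.smul_cons, Matrix.smul_cons, Matrix.smul_empty] at this
    · refine (half_lt_self hε).trans_le (le_ciInf fun k => ?_)
      simpa only [Pi.smul_apply, smul_smul] using hz i j hij (k * g)
  tfae_have 2 → 3 := by
    rintro ⟨δ, hδ, H⟩
    obtain ⟨x, -, hQ, hsep⟩ := H univ isOpen_univ univ_nonempty
    have : Nonempty (Fin m) := ⟨⟨0, by omega⟩⟩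
    obtain ⟨z, hz, hzsep⟩ := TopDyn.exists_separated_tuple_in_fibre (δ := δ)
      (fun i j => TopDyn.piEq_eq_iff.2 (hQ i j).eqRel)
      (fun i j hij g => (hsep i j hij).le.trans
        (ciInf_le ⟨0, forall_mem_range.2 fun _ => dist_nonneg⟩ g)) y
    exact le_sSup ⟨m, by omega, rfl, z, hz, fun i j hij =>
      TopDyn.not_isProximalPair_iff.2 ⟨δ, hδ, hzsep i j hij⟩⟩
  tfae_have 3 → 1 := TopDyn.CompactlySensitive.of_le_coincidenceRank (by omega)
  tfae_finish
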